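/- Let $\alpha$ be an infinite ordinal. Consider algebras (with nonempty carrier) of the similarity type $\{\cdot,-,s^i_j,s_{ij}\}_{i\neq j\in\alpha}$, where $\cdot$ is binary and $-$, $s^i_j$, $s_{ij}$ are unary; $x+y$ abbreviates $-(-x\cdot-y)$, $0$ stands for $x\cdot -x$, $1$ for $x+-x$, and $x\le y$ means $x\cdot y=x$. Let $\Sigma_\alpha$ be the following set of equations, where $i,j,k,l$ range over all distinct elements of $\alpha$: 1. the axioms of Boolean algebras; 2. each $s_{ij}$ and each $s^i_j$ preserves $\cdot$, $+$, $0$ and $1$ (that is, it is a Boolean endomorphism); 3. $s_{ij}x=s_{ji}x$, $\;s_{ij}s_{ij}x=x$, $\;s_{ij}s_{jk}s_{ij}x=s_{ik}x$, $\;s_{ij}s_{kl}x=s_{kl}s_{ij}x$; 4. $s_{kl}s^j_is_{kl}x=s^j_ix$, $\;s_{jk}s^j_is_{jk}x=s^k_ix$, $\;s_{ki}s^j_is_{ki}x=s^j_kx$, $\;s_{ij}s^j_is_{ij}x=s^i_jx$; 5. $s^j_is^k_lx=s^k_ls^j_ix$, $\;s^j_is^k_ix=s^k_is^j_ix=s^j_is^k_jx$,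 $\;s^j_is^i_kx=s^j_ks_{ij}x$, $\;s^j_is^j_kx=s^j_kx$, $\;s^j_is^j_ix=s^j_ix$, $\;s^j_is^i_jx=s^j_ix$, $\;s^j_is_{ij}x=s^j_ix$. Let $SA_\alpha=\mathbf{Mod}(\Sigma_\alpha)$ be the class of all algebras of this type that satisfy $\Sigma_\alpha$. For $i,j\in\alpha$ let $[i|j]:\alpha\to\alpha$ be the map that takes $i$ to $j$ and fixes all other elements, and let $[i,j]$ be the transposition of $i$ and $j$. Let ${}^\alpha\alpha^{(Id)}=\{s\in{}^\alpha\alpha:\{i:s_i\neq i\}\text{ is finite}\}$. A set $V\subseteq{}^\alpha\alpha^{(Id)}$ is locally square if $s\circ[i|j]\in V$ and $s\circ[i,j]\in V$ whenever $s\in V$ and $i,j\in\alpha$. For such a $V$ let $\wp(V)=\langle\mathcal P(V),\cap,\sim,S^i_j,S_{ij}\rangle_{i\ne j\in\alpha}$, where $\sim$ is complement relative to $V$, $S^i_jX=\{q\in V:q\circ[i|j]\in X\}$ and $S_{ij}X=\{q\in V:q\circ[i,j]\in X\}$. Let $WSA_\alpha$ be the variety generated by all algebras $\wp(V)$ with $V\subseteq{}^\alpha\alpha^{(Id)}$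 locally square, that is, the smallest class of algebras that contains them and is closed under homomorphic images, (isomorphic copies of) subalgebras and direct products. Then: (1) $SA_\alpha=WSA_\alpha$. (2) $SA_\alpha$ has the superamalgamation property: for all $A,B,C\in SA_\alpha$ and all injective homomorphisms $f:A\to B$, $g:A\to C$ there are $D\in SA_\alpha$ and injective homomorphisms $m:B\to D$, $n:C\to D$ with $m\circ f=n\circ g$ such that for all $b\in B$ and $c\in C$: if $m(b)\le n(c)$, then there is $a\in A$ with $b\le f(a)$ and $g(a)\le c$; and if $n(c)\le m(b)$, then there is $a\in A$ with $c\le g(a)$ and $f(a)\le b$. -/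

import Mathlib

open FirstOrder

universe u

namespace SubstAlg

/-- Operation symbols of the similarity type `{·, -, sⁱⱼ, s_ij}`, for distinct `i, j ∈ I`. -/
inductive Op (I : Type u) : ℕ → Type u
  | meet : Op I 2
  | compl : Op I 1
  /-- `repl i j` is the symbol `sⁱⱼ`, with upper index `i` and lower index `j`. -/
  | repl (i j : I) (h : i ≠ j) : Op I 1
  /-- `transp i j` is the symbol `s_ij`. -/
  | transp (i j : I) (h : i ≠ j) : Op I 1

/-- The algebraic language with operation symbols `·, -, sⁱⱼ, s_ij`. -/
def lang (I : Type u) : FirstOrder.Language.{u, 0} := ⟨Op I, fun _ => Empty⟩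

/-- An algebra of this similarity type, with nonempty carrier. -/
structure Alg (I : Type u) where
  carrier : Type u
  [nonempty : Nonempty carrier]
  [str : (lang I).Structure carrier]

attribute [instance] Alg.nonempty Alg.str

instance (I : Type u) : CoeSort (Alg.{u} I) (Type u) := ⟨Alg.carrier⟩

/-! ### Terms, equations and the axioms -/

/-- Terms in the variables `v₀, v₁, …`. -/
abbrev Tm (I : Type u) := (lang I).Term ℕ

section Terms

variable {I : Type u}

/-- `s · t` -/
def Tm.meet (s t : Tm I) : Tm I := FirstOrder.Language.Term.func (L := lang I) (l := 2) Op.meet ![s, t]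

/-- `- t` -/
def Tm.neg (t : Tm I) : Tm I := FirstOrder.Language.Term.func (L := lang I) (l := 1) Op.compl ![t]

/-- `s + t`, an abbreviation of `-(-s · -t)` -/
def Tm.join (s t : Tm I) : Tm I := ((s.neg).meet t.neg).neg

/-- `sⁱⱼ t` -/
def Tm.repl (i j : I) (h : i ≠ j) (t : Tm I) : Tm I :=
  FirstOrder.Language.Term.func (L := lang I) (l := 1) (Op.repl i j h) ![t]

/-- `s_ij t` -/
def Tm.transp (i j : I) (h : i ≠ j) (t : Tm I) : Tm I :=
  FirstOrder.Language.Term.func (L := lang I) (l := 1) (Op.transp i j h) ![t]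

/-- The variable `v₀`. -/
def Tm.x : Tm I := FirstOrder.Language.Term.var 0
/-- The variable `v₁`. -/
def Tm.y : Tm I := FirstOrder.Language.Term.var 1
/-- The variable `v₂`. -/
def Tm.z : Tm I := FirstOrder.Language.Term.var 2

/-- `0`, as the term `x · -x` -/
def Tm.zero : Tm I := Tm.x.meet Tm.x.neg

/-- `1`, as the term `x + -x` -/
def Tm.one : Tm I := Tm.x.join Tm.x.neg

end Terms

open Tm in
/-- `Ax I s t` says that the equation `s = t` belongs to the axiom system `Σ_I`, which is given by
finitely many schemas, whose indices range over all tuples of distinct members of `I`. -/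
inductive Ax (I : Type u) : Tm I → Tm I → Prop
  -- the Boolean axioms
  | meet_comm : Ax I (x.meet y) (y.meet x)
  | meet_assoc : Ax I (x.meet (y.meet z)) ((x.meet y).meet z)
  | join_comm : Ax I (x.join y) (y.join x)
  | join_assoc : Ax I (x.join (y.join z)) ((x.join y).join z)
  | meet_join_absorb : Ax I (x.meet (x.join y)) x
  | join_meet_absorb : Ax I (x.join (x.meet y)) x
  | meet_join_distrib : Ax I (x.meet (y.join z)) ((x.meet y).join (x.meet z))
  | join_meet_distrib : Ax I (x.join (y.meet z)) ((x.join y).meet (x.join z))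
  | join_zero : Ax I (y.join zero) y
  | meet_one : Ax I (y.meet one) y
  -- the substitution operations are Boolean endomorphisms
  | transp_meet (i j : I) (h : i ≠ j) :
      Ax I ((x.meet y).transp i j h) ((x.transp i j h).meet (y.transp i j h))
  | transp_join (i j : I) (h : i ≠ j) :
      Ax I ((x.join y).transp i j h) ((x.transp i j h).join (y.transp i j h))
  | transp_zero (i j : I) (h : i ≠ j) : Ax I (zero.transp i j h) zero
  | transp_one (i j : I) (h : i ≠ j) : Ax I (one.transp i j h) one
  | repl_meet (i j : I) (h : i ≠ j) :
      Ax I ((x.meet y).repl i j h) ((x.repl i j h).meet (y.repl i j h))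
  | repl_join (i j : I) (h : i ≠ j) :
      Ax I ((x.join y).repl i j h) ((x.repl i j h).join (y.repl i j h))
  | repl_zero (i j : I) (h : i ≠ j) : Ax I (zero.repl i j h) zero
  | repl_one (i j : I) (h : i ≠ j) : Ax I (one.repl i j h) one
  -- the relations between transpositions
  /-- `s_ij x = s_ji x` -/
  | transp_symm (i j : I) (hij : i ≠ j) : Ax I (transp i j hij x) (transp j i hij.symm x)
  /-- `s_ij s_ij x = x` -/
  | transp_transp (i j : I) (hij : i ≠ j) : Ax I (transp i j hij (transp i j hij x)) x
  /-- `s_ij s_jk s_ij x = s_ik x` -/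
  | transp_conj (i j k : I) (hij : i ≠ j) (hik : i ≠ k) (hjk : j ≠ k) :
      Ax I (transp i j hij (transp j k hjk (transp i j hij x))) (transp i k hik x)
  /-- `s_ij s_kl x = s_kl s_ij x` -/
  | transp_comm (i j k l : I) (hij : i ≠ j) (hik : i ≠ k) (hil : i ≠ l) (hjk : j ≠ k)
      (hjl : j ≠ l) (hkl : k ≠ l) :
      Ax I (transp i j hij (transp k l hkl x)) (transp k l hkl (transp i j hij x))
  -- the relations that involve replacements
  /-- `s_kl sʲᵢ s_kl x = sʲᵢ x` -/
  | conj_disjoint (i j k l : I) (hij : i ≠ j) (hik : i ≠ k) (hil : i ≠ l) (hjk : j ≠ k)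
      (hjl : j ≠ l) (hkl : k ≠ l) :
      Ax I (transp k l hkl (repl j i hij.symm (transp k l hkl x))) (repl j i hij.symm x)
  /-- `s_jk sʲᵢ s_jk x = sᵏᵢ x` -/
  | conj_upper (i j k : I) (hij : i ≠ j) (hik : i ≠ k) (hjk : j ≠ k) :
      Ax I (transp j k hjk (repl j i hij.symm (transp j k hjk x))) (repl k i hik.symm x)
  /-- `s_ki sʲᵢ s_ki x = sʲₖ x` -/
  | conj_lower (i j k : I) (hij : i ≠ j) (hik : i ≠ k) (hjk : j ≠ k) :
      Ax I (transp k i hik.symm (repl j i hij.symm (transp k i hik.symm x))) (repl j k hjk x)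
  /-- `s_ij sʲᵢ s_ij x = sⁱⱼ x` -/
  | conj_both (i j : I) (hij : i ≠ j) :
      Ax I (transp i j hij (repl j i hij.symm (transp i j hij x))) (repl i j hij x)
  /-- `sʲᵢ sᵏₗ x = sᵏₗ sʲᵢ x` -/
  | repl_comm_disjoint (i j k l : I) (hij : i ≠ j) (hik : i ≠ k) (hil : i ≠ l) (hjk : j ≠ k)
      (hjl : j ≠ l) (hkl : k ≠ l) :
      Ax I (repl j i hij.symm (repl k l hkl x)) (repl k l hkl (repl j i hij.symm x))
  /-- `sʲᵢ sᵏᵢ x = sᵏᵢ sʲᵢ x` -/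
  | repl_comm_lower (i j k : I) (hij : i ≠ j) (hik : i ≠ k) (hjk : j ≠ k) :
      Ax I (repl j i hij.symm (repl k i hik.symm x)) (repl k i hik.symm (repl j i hij.symm x))
  /-- `sᵏᵢ sʲᵢ x = sʲᵢ sᵏⱼ x` -/
  | repl_chain (i j k : I) (hij : i ≠ j) (hik : i ≠ k) (hjk : j ≠ k) :
      Ax I (repl k i hik.symm (repl j i hij.symm x)) (repl j i hij.symm (repl k j hjk.symm x))
  /-- `sʲᵢ sⁱₖ x = sʲₖ s_ij x` -/
  | repl_repl_transp (i j k : I) (hij : i ≠ j) (hik : i ≠ k) (hjk : j ≠ k) :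
      Ax I (repl j i hij.symm (repl i k hik x)) (repl j k hjk (transp i j hij x))
  /-- `sʲᵢ sʲₖ x = sʲₖ x` -/
  | repl_upper (i j k : I) (hij : i ≠ j) (hik : i ≠ k) (hjk : j ≠ k) :
      Ax I (repl j i hij.symm (repl j k hjk x)) (repl j k hjk x)
  /-- `sʲᵢ sʲᵢ x = sʲᵢ x` -/
  | repl_idem (i j : I) (hij : i ≠ j) :
      Ax I (repl j i hij.symm (repl j i hij.symm x)) (repl j i hij.symm x)
  /-- `sʲᵢ sⁱⱼ x = sʲᵢ x` -/
  | repl_swap (i j : I) (hij : i ≠ j) :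
      Ax I (repl j i hij.symm (repl i j hij x)) (repl j i hij.symm x)
  /-- `sʲᵢ s_ij x = sʲᵢ x` -/
  | repl_transp (i j : I) (hij : i ≠ j) :
      Ax I (repl j i hij.symm (transp i j hij x)) (repl j i hij.symm x)

/-- The set of equations `Σ_I`, an equation being a pair of terms. -/
def SigmaEqs (I : Type u) : Set (Tm I × Tm I) := {e | Ax I e.1 e.2}

/-- The class of all algebras in which every equation of `E` is valid. -/
def Mod {I : Type u} (E : Set (Tm I × Tm I)) : Set (Alg.{u} I) :=
  {A | ∀ e ∈ E, ∀ v : ℕ → A, e.1.realize v = e.2.realize v}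

/-- `SA_I = Mod(Σ_I)`. -/
def SA (I : Type u) : Set (Alg.{u} I) := Mod (SigmaEqs I)

/-! ### Varieties -/

/-- The direct product of a family of algebras, with pointwise operations. -/
def prod {I : Type u} {J : Type u} (A : J → Alg.{u} I) : Alg.{u} I where
  carrier := ∀ j, A j
  str :=
    { funMap := fun f a j => FirstOrder.Language.Structure.funMap f fun n => a n j
      RelMap := fun r _ => r.elim }

/-- A variety: a class of algebras closed under homomorphic images, (isomorphic copies of)
subalgebras, and direct products. -/
structure IsVariety {I : Type u} (K : Set (Alg.{u} I)) : Prop where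
  image : ∀ A ∈ K, ∀ B : Alg.{u} I, ∀ f : A →[lang I] B, Function.Surjective f → B ∈ K
  sub : ∀ B ∈ K, ∀ A : Alg.{u} I, ∀ f : A →[lang I] B, Function.Injective f → A ∈ K
  prod : ∀ (J : Type u) (A : J → Alg.{u} I), (∀ j, A j ∈ K) → prod A ∈ K

/-- The variety generated by `K`: the smallest variety that includes `K`. -/
def generatedVariety {I : Type u} (K : Set (Alg.{u} I)) : Set (Alg.{u} I) :=
  ⋂₀ {W | IsVariety W ∧ K ⊆ W}

/-! ### Locally square set algebras -/

open Classical in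
/-- The replacement `[i|j]`, which takes `i` to `j` and fixes everything else. -/
noncomputable def replMap {I : Type u} (i j : I) : I → I := Function.update id i j

open Classical in
/-- The transposition `[i,j]`. -/
noncomputable def transpMap {I : Type u} (i j : I) : I → I := Equiv.swap i j

/-- The weak set `ᴵI^(Id)`: the maps that differ from the identity at finitely many points. -/
def weakSet (I : Type u) : Set (I → I) := {s | {i | s i ≠ i}.Finite}

/-- `V` is locally square: it is closed under `s ↦ s ∘ [i|j]` and `s ↦ s ∘ [i,j]`. -/
def LocallySquare {I : Type u} (V : Set (I → I)) : Prop :=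
  ∀ s ∈ V, ∀ i j : I, s ∘ replMap i j ∈ V ∧ s ∘ transpMap i j ∈ V

/-- `{q ∈ V : q ∘ σ ∈ X}` for a subset `X` of `V`. -/
def setSubst {I : Type u} {V : Set (I → I)} (σ : I → I) (X : Set V) : Set V :=
  {q | ∃ p ∈ X, (p : I → I) = (q : I → I) ∘ σ}

/-- The operations of `℘(V)`. -/
def setOp {I : Type u} (V : Set (I → I)) : {n : ℕ} → Op I n → (Fin n → Set V) → Set V
  | _, .meet, X => X 0 ∩ X 1
  | _, .compl, X => (X 0)ᶜ
  | _, .repl i j _, X => setSubst (replMap i j) (X 0)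
  | _, .transp i j _, X => setSubst (transpMap i j) (X 0)

/-- The set algebra `℘(V) = ⟨𝒫(V), ∩, ∼, Sⁱⱼ, S_ij⟩`, with `Sⁱⱼ X = {q ∈ V : q ∘ [i|j] ∈ X}` and
`S_ij X = {q ∈ V : q ∘ [i,j] ∈ X}`. -/
def setAlg {I : Type u} (V : Set (I → I)) : Alg.{u} I where
  carrier := Set V
  str :=
    { funMap := fun f X => setOp V f X
      RelMap := fun r _ => r.elim }

/-- `WSA_I`, the variety generated by the algebras `℘(V)` with `V ⊆ ᴵI^(Id)` locally square. -/
def WSA (I : Type u) : Set (Alg.{u} I) :=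
  generatedVariety {A | ∃ V : Set (I → I), V ⊆ weakSet I ∧ LocallySquare V ∧ A = setAlg V}

/-! ### Superamalgamation -/

/-- The Boolean order of an algebra: `a ≤ b` iff `a · b = a`. -/
def le {I : Type u} {A : Alg.{u} I} (a b : A) : Prop :=
  FirstOrder.Language.Structure.funMap (L := lang I) (n := 2) Op.meet ![a, b] = a

/-- The superamalgamation property of a class of algebras. -/
def HasSuperamalgamation {I : Type u} (K : Set (Alg.{u} I)) : Prop :=
  ∀ A ∈ K, ∀ B ∈ K, ∀ C ∈ K, ∀ (f : A →[lang I] B) (g : A →[lang I] C),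
    Function.Injective f → Function.Injective g →
    ∃ D ∈ K, ∃ (m : B →[lang I] D) (n : C →[lang I] D),
      Function.Injective m ∧ Function.Injective n ∧ (∀ a : A, m (f a) = n (g a)) ∧
      (∀ (b : B) (c : C), le (m b) (n c) → ∃ a : A, le b (f a) ∧ le (g a) c) ∧
      (∀ (b : B) (c : C), le (n c) (m b) → ∃ a : A, le c (g a) ∧ le (f a) b)

end SubstAlg

/-!
The equations of `Σ_I` in one variable say that `sⁱⱼ` and `s_ij` satisfy the relations of a monoid
`M` given by generators `[i|j]` and `[i,j]`, and the remaining ones say that the operations are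
Boolean and that `M` acts by Boolean endomorphisms. Both claims follow by duality: the ultrafilters
of an algebra carry a right action of `M`, and the complex algebra of any right action satisfies
`Σ_I`.

For the representation, the point is that for infinite `I` the monoid `M` acts faithfully on `I`.
Given `m` in `M`, there is a product `e` of replacements that collapses the kernel of `m` to a
transversal and that `m` absorbs, `m * e = m`. As `m` is injective on the transversal, each factor
`[i|j]` of `m` can be exchanged for a transposition in front of `e`; this uses an index outside
`{i, j}`. So `m = u * e` with `u` a product of transpositions, and `u` is determined by the
transformation `m` up to permutations of points that `e` omits. Hence `M` is a locally square set
`V`, and each ultrafilter `φ` gives a homomorphism `a ↦ {m ∈ V : φ (m a)}` to `℘(V)`.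

The amalgam of `B` and `C` over `A` is the complex algebra of the pairs of ultrafilters, of `B` and
of `C`, with the same restriction to `A`. If no element of `A` lies between `b` and `c`, then an
ultrafilter of `A` separates the elements above `b` from those below `c`, and it extends to such a
pair that contains `b` and omits `c`.
-/

namespace SubstAlg

variable {I : Type u}

/-! ### The monoid of substitutions -/

theorem replMap_apply [DecidableEq I] (i j x : I) : replMap i j x = if x = i then j else x := by
  simp [replMap, Function.update_apply]

theorem transpMap_apply [DecidableEq I] (i j x : I) :
    transpMap i j x = if x = i then j else if x = j then i else x := by
  simp only [transpMap, Equiv.swap_apply_def]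
  congr

theorem transpMap_transpMap (i j x : I) : transpMap i j (transpMap i j x) = x := by
  classical
  simp [transpMap]

/-- Names of the replacements `[i|j]` and the transpositions `[i,j]`. The diagonal `i = j`, which
the similarity type excludes, names the identity: this saves case distinctions. -/
inductive Gen (I : Type u)
  | repl (i j : I)
  | transp (i j : I)

/-- The transformation of `I` that a generator names. -/
noncomputable def Gen.map : Gen I → Function.End I
  | .repl i j => replMap i j
  | .transp i j => transpMap i j

theorem Gen.map_repl_smul (i j x : I) : Gen.map (.repl i j) • x = replMap i j x := rfl

theorem Gen.map_transp_smul (i j x : I) : Gen.map (.transp i j) • x = transpMap i j x := rfl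

open FreeMonoid Gen in
/-- The equations of `Σ_I` that involve one variable only, read as relations between products of
substitutions. -/
inductive SubstRel : FreeMonoid (Gen I) → FreeMonoid (Gen I) → Prop
  | repl_self (i : I) : SubstRel (of (repl i i)) 1
  | transp_self (i : I) : SubstRel (of (transp i i)) 1
  | transp_symm (i j : I) : i ≠ j → SubstRel (of (transp i j)) (of (transp j i))
  | transp_transp (i j : I) : i ≠ j → SubstRel (of (transp i j) * of (transp i j)) 1
  | transp_conj (i j k : I) : i ≠ j → i ≠ k → j ≠ k →
      SubstRel (of (transp i j) * (of (transp j k) * of (transp i j))) (of (transp i k))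
  | transp_comm (i j k l : I) : i ≠ j → i ≠ k → i ≠ l → j ≠ k → j ≠ l → k ≠ l →
      SubstRel (of (transp i j) * of (transp k l)) (of (transp k l) * of (transp i j))
  | conj_disjoint (i j k l : I) : i ≠ j → i ≠ k → i ≠ l → j ≠ k → j ≠ l → k ≠ l →
      SubstRel (of (transp k l) * (of (repl j i) * of (transp k l))) (of (repl j i))
  | conj_upper (i j k : I) : i ≠ j → i ≠ k → j ≠ k →
      SubstRel (of (transp j k) * (of (repl j i) * of (transp j k))) (of (repl k i))
  | conj_lower (i j k : I) : i ≠ j → i ≠ k → j ≠ k →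
      SubstRel (of (transp k i) * (of (repl j i) * of (transp k i))) (of (repl j k))
  | conj_both (i j : I) : i ≠ j →
      SubstRel (of (transp i j) * (of (repl j i) * of (transp i j))) (of (repl i j))
  | repl_comm_disjoint (i j k l : I) : i ≠ j → i ≠ k → i ≠ l → j ≠ k → j ≠ l → k ≠ l →
      SubstRel (of (repl j i) * of (repl k l)) (of (repl k l) * of (repl j i))
  | repl_comm_lower (i j k : I) : i ≠ j → i ≠ k → j ≠ k →
      SubstRel (of (repl j i) * of (repl k i)) (of (repl k i) * of (repl j i))
  | repl_chain (i j k : I) : i ≠ j → i ≠ k → j ≠ k →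
      SubstRel (of (repl k i) * of (repl j i)) (of (repl j i) * of (repl k j))
  | repl_repl_transp (i j k : I) : i ≠ j → i ≠ k → j ≠ k →
      SubstRel (of (repl j i) * of (repl i k)) (of (repl j k) * of (transp i j))
  | repl_upper (i j k : I) : i ≠ j → i ≠ k → j ≠ k →
      SubstRel (of (repl j i) * of (repl j k)) (of (repl j k))
  | repl_idem (i j : I) : i ≠ j → SubstRel (of (repl j i) * of (repl j i)) (of (repl j i))
  | repl_swap (i j : I) : i ≠ j → SubstRel (of (repl j i) * of (repl i j)) (of (repl j i))
  | repl_transp (i j : I) : i ≠ j → SubstRel (of (repl j i) * of (transp i j)) (of (repl j i))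

/-- The monoid that `Σ_I` presents. It acts on every algebra of `SA_I` and, through the
transformations that the generators name, on `I`. -/
abbrev SubstMonoid (I : Type u) := PresentedMonoid (SubstRel (I := I))

namespace SubstMonoid

/-- The element `[i|j]` of the substitution monoid. -/
def repl (i j : I) : SubstMonoid I := PresentedMonoid.of _ (.repl i j)

/-- The element `[i,j]` of the substitution monoid. -/
def transp (i j : I) : SubstMonoid I := PresentedMonoid.of _ (.transp i j)

theorem mk_eq_mk {v w : FreeMonoid (Gen I)} (h : SubstRel v w) :
    PresentedMonoid.mk SubstRel v = PresentedMonoid.mk SubstRel w :=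
  PresentedMonoid.mk_eq_mk_of_rel h

@[elab_as_elim]
theorem induction_left {p : SubstMonoid I → Prop} (one : p 1)
    (repl_mul : ∀ i j m, p m → p (repl i j * m)) (transp_mul : ∀ i j m, p m → p (transp i j * m))
    (m : SubstMonoid I) : p m :=
  Submonoid.induction_of_closure_eq_top_left (PresentedMonoid.closure_range_of _) m one fun
    | _, ⟨.repl i j, rfl⟩ => repl_mul i j
    | _, ⟨.transp i j, rfl⟩ => transp_mul i j

@[elab_as_elim]
theorem induction_right {p : SubstMonoid I → Prop} (one : p 1)
    (mul_repl : ∀ m i j, p m → p (m * repl i j)) (mul_transp : ∀ m i j, p m → p (m * transp i j))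
    (m : SubstMonoid I) : p m :=
  Submonoid.induction_of_closure_eq_top_right (PresentedMonoid.closure_range_of _) m one fun
    | m, _, ⟨.repl i j, rfl⟩ => mul_repl m i j
    | m, _, ⟨.transp i j, rfl⟩ => mul_transp m i j

theorem lift_map_eq {v w : FreeMonoid (Gen I)} (h : SubstRel v w) :
    FreeMonoid.lift Gen.map v = FreeMonoid.lift Gen.map w := by
  classical
  cases h <;>
    · refine eq_of_smul_eq_smul (α := I) fun x => ?_
      simp only [map_mul, map_one, FreeMonoid.lift_eval_of, mul_smul, one_smul, Gen.map_repl_smul,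
        Gen.map_transp_smul, replMap_apply, transpMap_apply]
      grind

/-- The transformation of `I` that an element of the substitution monoid represents. -/
noncomputable def toMap : SubstMonoid I →* Function.End I :=
  PresentedMonoid.lift Gen.map fun _ _ => lift_map_eq

noncomputable instance : MulAction (SubstMonoid I) I := MulAction.compHom I toMap

theorem repl_smul (i j x : I) : repl i j • x = replMap i j x := rfl

theorem transp_smul (i j x : I) : transp i j • x = transpMap i j x := rfl

theorem repl_self (i : I) : repl i i = 1 := mk_eq_mk (.repl_self i)

theorem transp_self (i : I) : transp i i = 1 := mk_eq_mk (.transp_self i)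

theorem transp_comm (i j : I) : transp i j = transp j i := by
  obtain rfl | h := eq_or_ne i j
  · rfl
  · exact mk_eq_mk (.transp_symm i j h)

theorem transp_mul_self (i j : I) : transp i j * transp i j = 1 := by
  obtain rfl | h := eq_or_ne i j
  · simp only [transp_self, mul_one]
  · exact mk_eq_mk (.transp_transp i j h)

theorem repl_mul_repl_upper {a c : I} (b : I) (h : c ≠ a) :
    repl a b * repl a c = repl a c := by
  obtain rfl | hab := eq_or_ne b a
  · rw [repl_self, one_mul]
  obtain rfl | hbc := eq_or_ne b c
  · exact mk_eq_mk (.repl_idem b a hab)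
  · exact mk_eq_mk (.repl_upper b a c hab hbc h.symm)

theorem repl_mul_repl_swap (a b : I) : repl a b * repl b a = repl a b := by
  obtain rfl | h := eq_or_ne b a
  · rw [repl_self, one_mul]
  · exact mk_eq_mk (.repl_swap b a h)

theorem repl_mul_repl_of_ne {a b x : I} (y : I) (hxa : x ≠ a) (hxb : x ≠ b) :
    repl a b * repl x y = repl x (replMap a b y) * repl a b := by
  classical
  rw [replMap_apply]
  obtain rfl | hab := eq_or_ne a b
  · split_ifs with h <;> simp only [repl_self, one_mul, mul_one, h]
  by_cases hya : y = a
  · subst hya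
    rw [if_pos rfl]
    exact (mk_eq_mk (.repl_chain b y x hab.symm hxb.symm hxa.symm)).symm
  rw [if_neg hya]
  obtain rfl | hyb := eq_or_ne y b
  · exact mk_eq_mk (.repl_comm_lower y a x hya hxb.symm hxa.symm)
  obtain rfl | hyx := eq_or_ne y x
  · simp only [repl_self, one_mul, mul_one]
  · exact mk_eq_mk (.repl_comm_disjoint b a x y hab.symm hxb.symm hyb.symm hxa.symm
      (Ne.symm hya) hyx.symm)

theorem repl_mul_repl_of_ne_ne {a b c : I} (hab : a ≠ b) (hac : a ≠ c) (hbc : b ≠ c) :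
    repl a b * repl b c = repl a c * transp a b := by
  rw [transp_comm]
  exact mk_eq_mk (.repl_repl_transp b a c hab.symm hbc hac)

theorem transp_mul_transp_mul_transp (i j a b : I) :
    transp i j * (transp a b * transp i j) = transp (transpMap i j a) (transpMap i j b) := by
  classical
  obtain rfl | hij := eq_or_ne i j
  · simp [transp_self, transpMap]
  obtain rfl | hab := eq_or_ne a b
  · simp only [transp_self, one_mul, transp_mul_self]
  have conj (i j k : I) (hij : i ≠ j) (hik : i ≠ k) (hjk : j ≠ k) :
      transp i j * (transp j k * transp i j) = transp i k :=
    mk_eq_mk (.transp_conj i j k hij hik hjk)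
  have comm (i j k l : I) (hij : i ≠ j) (hik : i ≠ k) (hil : i ≠ l) (hjk : j ≠ k) (hjl : j ≠ l)
      (hkl : k ≠ l) : transp i j * (transp k l * transp i j) = transp k l := by
    rw [show transp k l * transp i j = transp i j * transp k l from
      (mk_eq_mk (.transp_comm i j k l hij hik hil hjk hjl hkl)).symm, ← mul_assoc, transp_mul_self,
      one_mul]
  grind [transpMap_apply, transp_comm, transp_mul_self, mul_one]

theorem transp_mul_repl_mul_transp (i j a b : I) :
    transp i j * (repl a b * transp i j) = repl (transpMap i j a) (transpMap i j b) := by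
  classical
  obtain rfl | hij := eq_or_ne i j
  · simp [transp_self, transpMap]
  obtain rfl | hab := eq_or_ne a b
  · simp only [repl_self, one_mul, transp_mul_self]
  have disjoint (i j k l : I) (hij : i ≠ j) (hik : i ≠ k) (hil : i ≠ l) (hjk : j ≠ k) (hjl : j ≠ l)
      (hkl : k ≠ l) : transp k l * (repl j i * transp k l) = repl j i :=
    mk_eq_mk (.conj_disjoint i j k l hij hik hil hjk hjl hkl)
  have upper (i j k : I) (hij : i ≠ j) (hik : i ≠ k) (hjk : j ≠ k) :
      transp j k * (repl j i * transp j k) = repl k i :=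
    mk_eq_mk (.conj_upper i j k hij hik hjk)
  have lower (i j k : I) (hij : i ≠ j) (hik : i ≠ k) (hjk : j ≠ k) :
      transp k i * (repl j i * transp k i) = repl j k :=
    mk_eq_mk (.conj_lower i j k hij hik hjk)
  have both (i j : I) (hij : i ≠ j) : transp i j * (repl j i * transp i j) = repl i j :=
    mk_eq_mk (.conj_both i j hij)
  grind [transpMap_apply, transp_comm]

theorem transp_mul_transp (i j a b : I) :
    transp i j * transp a b = transp (transpMap i j a) (transpMap i j b) * transp i j := by
  rw [← transp_mul_transp_mul_transp, mul_assoc, mul_assoc, transp_mul_self, mul_one]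

theorem transp_mul_repl (i j a b : I) :
    transp i j * repl a b = repl (transpMap i j a) (transpMap i j b) * transp i j := by
  rw [← transp_mul_repl_mul_transp, mul_assoc, mul_assoc, transp_mul_self, mul_one]

theorem mul_repl_eq_self_symm {m : SubstMonoid I} {x y : I} (h : m * repl x y = m) :
    m * repl y x = m := by
  rw [← h, mul_assoc, repl_mul_repl_swap]

theorem mul_repl_eq_self_of_smul_eq (m : SubstMonoid I) {x y : I} (h : m • x = m • y) :
    m * repl x y = m := by
  classical
  induction m using induction_right generalizing x y with
  | one =>
    obtain rfl : x = y := by simpa only [one_smul] using h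
    rw [repl_self, mul_one]
  | mul_transp m i j ih =>
    rw [mul_assoc, transp_mul_repl, ← mul_assoc, ih (by simpa only [mul_smul, transp_smul] using h)]
  | mul_repl m a b ih =>
    have of_ne {x y : I} (h : (m * repl a b) • x = (m * repl a b) • y) (hxa : x ≠ a) (hxb : x ≠ b) :
        m * repl a b * repl x y = m * repl a b := by
      rw [mul_assoc, repl_mul_repl_of_ne y hxa hxb, ← mul_assoc, ih]
      simpa only [mul_smul, repl_smul, replMap_apply, if_neg hxa] using h
    by_cases hx : x ≠ a ∧ x ≠ b
    · exact of_ne h hx.1 hx.2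
    by_cases hy : y ≠ a ∧ y ≠ b
    · exact mul_repl_eq_self_symm (of_ne h.symm hy.1 hy.2)
    have hab : repl a b * repl a b = repl a b := by
      obtain rfl | hba := eq_or_ne b a
      · rw [repl_self, mul_one]
      · exact repl_mul_repl_upper b hba
    rw [mul_assoc]
    congr 1
    grind [repl_self, mul_one, repl_mul_repl_swap]

/-! ### The presentation theorem -/

/-- `IsDead e a` says that `a` is redundant after `e`: it expresses, within the substitution monoid,
that `a` is not a value of the transformation `e`. -/
def IsDead (e : SubstMonoid I) (a : I) : Prop := ∀ b, repl a b * e = e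

theorem isDead_of_repl_mul_eq_self {e : SubstMonoid I} {a c : I} (hca : c ≠ a)
    (h : repl a c * e = e) : IsDead e a := fun b => by
  rw [← h, ← mul_assoc, repl_mul_repl_upper b hca]

theorem isDead_repl_mul (e : SubstMonoid I) {a b : I} (hba : b ≠ a) : IsDead (repl a b * e) a :=
  fun c => by rw [← mul_assoc, repl_mul_repl_upper c hba]

namespace IsDead

variable {e : SubstMonoid I} {a b : I}

theorem transp_mul (h : IsDead e a) (i j : I) : IsDead (transp i j * e) (transpMap i j a) :=
  fun c => by
    rw [← transpMap_transpMap i j c, ← mul_assoc, ← transp_mul_repl, mul_assoc, h]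

theorem repl_mul_eq_transp_mul [Infinite I] (h : IsDead e b) (a : I) :
    repl a b * e = transp a b * e := by
  obtain rfl | hab := eq_or_ne a b
  · rw [repl_self, transp_self]
  classical
  obtain ⟨c, hc⟩ := Infinite.exists_notMem_finset {a, b}
  simp only [Finset.mem_insert, Finset.mem_singleton, not_or] at hc
  calc repl a b * e = repl a b * repl b c * e := by rw [mul_assoc, h]
    _ = repl a c * transp a b * e := by
      rw [repl_mul_repl_of_ne_ne hab (Ne.symm hc.1) (Ne.symm hc.2)]
    _ = transp a b * repl b c * e := by
      rw [transp_mul_repl]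
      simp only [transpMap_apply, ↓reduceIte, hab.symm, hc.1, hc.2]
    _ = transp a b * e := by rw [mul_assoc, h]

theorem transp_mul_eq_self [Infinite I] (ha : IsDead e a) (hb : IsDead e b) :
    transp a b * e = e := by
  rw [← hb.repl_mul_eq_transp_mul, ha]

end IsDead

/-- A transposition as an invertible element of the substitution monoid. -/
def transpUnit (i j : I) : (SubstMonoid I)ˣ :=
  ⟨transp i j, transp i j, transp_mul_self i j, transp_mul_self i j⟩

@[simp]
theorem val_transpUnit (i j : I) : (transpUnit i j : SubstMonoid I) = transp i j := rfl

theorem transpUnit_smul (i j x : I) : transpUnit i j • x = transpMap i j x := rfl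

theorem transpUnit_self (i : I) : transpUnit i i = 1 := Units.ext (transp_self i)

theorem transpUnit_comm (i j : I) : transpUnit i j = transpUnit j i := Units.ext (transp_comm i j)

theorem transpUnit_mul_self (i j : I) : transpUnit i j * transpUnit i j = 1 :=
  Units.ext (transp_mul_self i j)

theorem inv_transpUnit (i j : I) : (transpUnit i j)⁻¹ = transpUnit i j := rfl

theorem transpUnit_mul_transpUnit (i j a b : I) :
    transpUnit i j * transpUnit a b =
      transpUnit (transpMap i j a) (transpMap i j b) * transpUnit i j :=
  Units.ext (transp_mul_transp i j a b)

/-- The subgroup generated by the transpositions of members of `S`. -/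
def transps (S : Set I) : Subgroup (SubstMonoid I)ˣ :=
  Subgroup.closure (Set.image2 transpUnit S S)

theorem transpUnit_mem_transps {S : Set I} {x y : I} (hx : x ∈ S) (hy : y ∈ S) :
    transpUnit x y ∈ transps S :=
  Subgroup.subset_closure (Set.mem_image2_of_mem hx hy)

theorem transps_mono {S T : Set I} (h : S ⊆ T) : transps S ≤ transps T :=
  Subgroup.closure_mono (Set.image2_subset h h)

theorem exists_transpUnit_mul_transpUnit_eq {S : Set I} {a b x y : I} (ha : a ∉ S)
    (hb : b ∈ insert a S) (hx : x ∈ insert a S) (hy : y ∈ insert a S) :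
    ∃ v ∈ transps S, ∃ c ∈ insert a S,
      transpUnit a b * transpUnit x y = v * transpUnit a c := by
  classical
  have of_left {y : I} (hy : y ∈ insert a S) :
      ∃ v ∈ transps S, ∃ c ∈ insert a S, transpUnit a b * transpUnit a y = v * transpUnit a c := by
    obtain rfl | hyS := hy
    · exact ⟨1, one_mem _, b, hb, by rw [transpUnit_self, mul_one, one_mul]⟩
    obtain rfl | hbS := hb
    · exact ⟨1, one_mem _, y, .inr hyS, by rw [transpUnit_self]⟩
    obtain rfl | hyb := eq_or_ne y b
    · exact ⟨1, one_mem _, a, .inl rfl, by rw [transpUnit_mul_self, transpUnit_self, one_mul]⟩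
    refine ⟨transpUnit b y, transpUnit_mem_transps hbS hyS, b, .inr hbS, ?_⟩
    rw [transpUnit_mul_transpUnit]
    simp only [transpMap_apply, ↓reduceIte, ne_of_mem_of_not_mem hyS ha, hyb]
  obtain rfl | hxS := hx
  · exact of_left hy
  obtain rfl | hyS := hy
  · rw [transpUnit_comm x]
    exact of_left (.inr hxS)
  have hax : a ≠ x := (ne_of_mem_of_not_mem hxS ha).symm
  have hay : a ≠ y := (ne_of_mem_of_not_mem hyS ha).symm
  refine ⟨transpUnit x y, transpUnit_mem_transps hxS hyS, transpMap x y b, ?_, ?_⟩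
  · rw [transpMap_apply]
    split_ifs
    exacts [.inr hyS, .inr hxS, hb]
  · rw [transpUnit_mul_transpUnit x y, transpMap_transpMap, transpMap_apply, if_neg hax, if_neg hay]

theorem exists_eq_mul_transpUnit {S : Set I} {a : I} (ha : a ∉ S) {u : (SubstMonoid I)ˣ}
    (hu : u ∈ transps (insert a S)) :
    ∃ v ∈ transps S, ∃ b ∈ insert a S, u = v * transpUnit a b := by
  have mul_transpUnit {u : (SubstMonoid I)ˣ} {x y : I} (hx : x ∈ insert a S) (hy : y ∈ insert a S) :
      (∃ v ∈ transps S, ∃ b ∈ insert a S, u = v * transpUnit a b) →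
        ∃ v ∈ transps S, ∃ b ∈ insert a S, u * transpUnit x y = v * transpUnit a b := by
    rintro ⟨v, hv, b, hb, rfl⟩
    obtain ⟨w, hw, c, hc, h⟩ := exists_transpUnit_mul_transpUnit_eq ha hb hx hy
    exact ⟨v * w, mul_mem hv hw, c, hc, by rw [mul_assoc, h, mul_assoc]⟩
  induction hu using Subgroup.closure_induction_right with
  | one => exact ⟨1, one_mem _, a, .inl rfl, by rw [transpUnit_self, one_mul]⟩
  | mul_right u _ t ht ih =>
    obtain ⟨x, hx, y, hy, rfl⟩ := ht
    exact mul_transpUnit hx hy ih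
  | mul_inv_cancel u _ t ht ih =>
    obtain ⟨x, hx, y, hy, rfl⟩ := ht
    exact mul_transpUnit hx hy ih

theorem smul_eq_of_mem_transps {S : Set I} {u : (SubstMonoid I)ˣ} (hu : u ∈ transps S) {a : I}
    (ha : a ∉ S) : u • a = a := by
  classical
  suffices transps S ≤ MulAction.stabilizer (SubstMonoid I)ˣ a from this hu
  rw [transps, Subgroup.closure_le]
  rintro _ ⟨x, hx, y, hy, rfl⟩
  rw [SetLike.mem_coe, MulAction.mem_stabilizer_iff, transpUnit_smul, transpMap_apply,
    if_neg (ne_of_mem_of_not_mem hx ha).symm, if_neg (ne_of_mem_of_not_mem hy ha).symm]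

theorem mem_transps_of_smul_eq {S : Set I} {a : I} {u : (SubstMonoid I)ˣ}
    (hu : u ∈ transps (insert a S)) (hua : u • a = a) : u ∈ transps S := by
  by_cases ha : a ∈ S
  · rwa [Set.insert_eq_of_mem ha] at hu
  obtain ⟨v, hv, b, -, rfl⟩ := exists_eq_mul_transpUnit ha hu
  have hvb : v • b = a := by
    rwa [mul_smul, transpUnit_smul, (by simp [transpMap] : transpMap a b a = b)] at hua
  obtain rfl : b = a := by
    rw [← inv_smul_eq_iff.2 hvb.symm, smul_eq_of_mem_transps (inv_mem hv) ha]
  rwa [transpUnit_self, mul_one]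

theorem exists_finite_mem_transps {S : Set I} {u : (SubstMonoid I)ˣ} (hu : u ∈ transps S) :
    ∃ F : Set I, F.Finite ∧ u ∈ transps F := by
  induction hu using Subgroup.closure_induction with
  | mem t ht =>
    obtain ⟨x, -, y, -, rfl⟩ := ht
    exact ⟨{x, y}, Set.toFinite _, transpUnit_mem_transps (.inl rfl) (.inr rfl)⟩
  | one => exact ⟨∅, Set.finite_empty, one_mem _⟩
  | mul u v _ _ hu hv =>
    obtain ⟨F, hF, hu⟩ := hu
    obtain ⟨G, hG, hv⟩ := hv
    exact ⟨F ∪ G, hF.union hG, mul_mem (transps_mono Set.subset_union_left hu)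
      (transps_mono Set.subset_union_right hv)⟩
  | inv u _ hu =>
    obtain ⟨F, hF, hu⟩ := hu
    exact ⟨F, hF, inv_mem hu⟩

theorem mem_transps_of_forall_smul_eq {S X : Set I} {u : (SubstMonoid I)ˣ} (hu : u ∈ transps S)
    (h : ∀ x ∉ X, u • x = x) : u ∈ transps X := by
  obtain ⟨F, hF, huF⟩ := exists_finite_mem_transps hu
  have huFX : u ∈ transps (F ∪ X) := transps_mono Set.subset_union_left huF
  clear huF
  induction F, hF using Set.Finite.induction_on with
  | empty => rwa [Set.empty_union] at huFX
  | @insert a F _ _ ih =>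
    rw [Set.insert_union] at huFX
    by_cases ha : a ∈ X
    · rw [Set.insert_eq_of_mem (.inr ha)] at huFX
      exact ih huFX
    · exact ih (mem_transps_of_smul_eq huFX (h a ha))

theorem mul_eq_self_of_mem_transps [Infinite I] {e : SubstMonoid I} {X : Set I}
    (hX : ∀ x ∈ X, IsDead e x) {u : (SubstMonoid I)ˣ} (hu : u ∈ transps X) : u * e = e := by
  suffices transps X ≤ MulAction.stabilizer (SubstMonoid I)ˣ e from this hu
  rw [transps, Subgroup.closure_le]
  rintro _ ⟨x, hx, y, hy, rfl⟩
  exact (hX x hx).transp_mul_eq_self (hX y hy)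

theorem IsDead.mul_of_mem_transps {S : Set I} {e : SubstMonoid I} {u : (SubstMonoid I)ˣ}
    (hu : u ∈ transps S) {a : I} (h : IsDead e a) : IsDead (u * e : SubstMonoid I) (u • a) := by
  induction hu using Subgroup.closure_induction_left with
  | one => simpa only [Units.val_one, one_mul, one_smul] using h
  | mul_left t ht u _ ih =>
    obtain ⟨x, -, y, -, rfl⟩ := ht
    rw [mul_smul, Units.val_mul, mul_assoc]
    exact ih.transp_mul x y
  | inv_mul_cancel t ht u _ ih =>
    obtain ⟨x, -, y, -, rfl⟩ := ht
    rw [inv_transpUnit, mul_smul, Units.val_mul, mul_assoc]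
    exact ih.transp_mul x y

theorem IsDead.repl_mul_of_notMem {e : SubstMonoid I} {x p q : I} (h : IsDead e x) (hxp : x ≠ p)
    (hxq : x ≠ q) : IsDead (repl p q * e) x := by
  classical
  refine isDead_of_repl_mul_eq_self hxq.symm ?_
  have comm := repl_mul_repl_of_ne q hxp hxq
  rw [replMap_apply, ite_self] at comm
  rw [← mul_assoc, ← comm, mul_assoc, h]

theorem exists_smul_eq_of_not_injOn_repl_mul {m : SubstMonoid I} {X : Set I} {a b : I}
    (hm : Set.InjOn (m • ·) Xᶜ) (h : ¬ Set.InjOn ((repl a b * m) • ·) Xᶜ) :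
    ∃ p ∉ X, ∃ q ∉ X, (repl a b * m) • p = (repl a b * m) • q ∧ q ≠ p ∧ m • p = a := by
  classical
  simp only [Set.InjOn, not_forall] at h
  obtain ⟨p, hp, q, hq, hpq, hne⟩ := h
  by_cases hpa : m • p = a
  · exact ⟨p, hp, q, hq, hpq, Ne.symm hne, hpa⟩
  refine ⟨q, hq, p, hp, hpq.symm, hne, ?_⟩
  by_contra hqa
  simp only [mul_smul, repl_smul, replMap_apply, if_neg hpa, if_neg hqa] at hpq
  exact hne (hm hp hq hpq)

theorem injOn_repl_mul_insert {m : SubstMonoid I} {X : Set I} {p b : I}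
    (hm : Set.InjOn (m • ·) Xᶜ) (hpX : p ∉ X) :
    Set.InjOn ((repl (m • p) b * m) • ·) (insert p X)ᶜ := by
  classical
  intro x hx y hy hxy
  simp only [Set.mem_compl_iff, Set.mem_insert_iff, not_or] at hx hy
  have ne {z : I} (hzp : z ≠ p) (hzX : z ∉ X) : m • z ≠ m • p := fun h => hzp (hm hzX hpX h)
  simp only [mul_smul, repl_smul, replMap_apply, ne hx.1 hx.2, ne hy.1 hy.2, if_false] at hxy
  exact hm hx.2 hy.2 hxy

/-- The factor `e` collapses one pair of points for each replacement in a word for `m` that is not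
injective on the values obtained so far, and `X` consists of the points that `e` removes. -/
theorem exists_isDead_injOn_mul_eq_self (m : SubstMonoid I) :
    ∃ (e : SubstMonoid I) (X : Set I), (∀ x ∈ X, IsDead e x) ∧ Set.InjOn (m • ·) Xᶜ ∧
      ∀ m' : SubstMonoid I, (∀ x y : I, m • x = m • y → m' • x = m' • y) → m' * e = m' := by
  classical
  induction m using induction_left with
  | one => exact ⟨1, ∅, by simp, by simp [Set.InjOn], by simp⟩
  | transp_mul i j m ih =>
    obtain ⟨e, X, hX, hm, he⟩ := ih
    refine ⟨e, X, hX, fun x hx y hy hxy => hm hx hy (smul_left_cancel (transpUnit i j) ?_),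
      fun m' hm' => he m' fun x y hxy => hm' x y (by rw [mul_smul, mul_smul, hxy])⟩
    simpa only [Units.smul_def, val_transpUnit, mul_smul] using hxy
  | repl_mul a b m ih =>
    obtain ⟨e, X, hX, hm, he⟩ := ih
    have absorb (m' : SubstMonoid I)
        (hm' : ∀ x y : I, (repl a b * m) • x = (repl a b * m) • y → m' • x = m' • y) :
        m' * e = m' := he m' fun x y hxy => hm' x y (by rw [mul_smul, mul_smul, hxy])
    by_cases h : Set.InjOn ((repl a b * m) • ·) Xᶜ
    · exact ⟨e, X, hX, h, absorb⟩
    obtain ⟨p, hp, q, hq, hpq, hne, rfl⟩ := exists_smul_eq_of_not_injOn_repl_mul hm h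
    refine ⟨repl p q * e, insert p X, ?_, injOn_repl_mul_insert hm hp, fun m' hm' => ?_⟩
    · rintro x (rfl | hx)
      · exact isDead_repl_mul e hne
      · exact (hX x hx).repl_mul_of_notMem (ne_of_mem_of_not_mem hx hp) (ne_of_mem_of_not_mem hx hq)
    · rw [← mul_assoc, mul_repl_eq_self_of_smul_eq m' (hm' p q hpq), absorb m' hm']

theorem exists_mem_transps_repl_mul_eq_mul [Infinite I] {S X : Set I} {u : (SubstMonoid I)ˣ}
    (hu : u ∈ transps S) {e : SubstMonoid I} (hX : ∀ x ∈ X, IsDead e x) {a b : I}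
    (hinj : Set.InjOn (fun x => repl a b • u • x) Xᶜ) :
    ∃ v ∈ transps (Set.univ : Set I), (∀ x ∉ X, v • x = repl a b • u • x) ∧
      repl a b * (u * e) = v * e := by
  classical
  have isDead {c : I} (hc : u⁻¹ • c ∈ X) : IsDead (u * e : SubstMonoid I) c := by
    simpa only [smul_inv_smul] using (hX _ hc).mul_of_mem_transps hu
  have ne {c x : I} (hc : u⁻¹ • c ∈ X) (hx : x ∉ X) : u • x ≠ c := fun h =>
    hx (by rwa [← h, inv_smul_smul] at hc)
  have huniv := transps_mono (Set.subset_univ S) hu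
  by_cases ha : u⁻¹ • a ∈ X
  · refine ⟨u, huniv, fun x hx => ?_, isDead ha b⟩
    rw [repl_smul, replMap_apply, if_neg (ne ha hx)]
  by_cases hb : u⁻¹ • b ∈ X
  · refine ⟨transpUnit a b * u, mul_mem (transpUnit_mem_transps trivial trivial) huniv, ?_, ?_⟩
    · intro x hx
      rw [mul_smul, transpUnit_smul, repl_smul, transpMap_apply, replMap_apply, if_neg (ne hb hx)]
    · rw [(isDead hb).repl_mul_eq_transp_mul, Units.val_mul, val_transpUnit, mul_assoc]
  obtain rfl : a = b := smul_left_cancel u⁻¹ <| hinj ha hb <| by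
    simp only [smul_inv_smul, repl_smul, replMap_apply, ↓reduceIte, ite_self]
  exact ⟨u, huniv, fun x _ => by rw [repl_self, one_smul], by rw [repl_self, one_mul]⟩

theorem exists_mem_transps_mul_eq_mul [Infinite I] (m : SubstMonoid I) {e : SubstMonoid I}
    {X : Set I}
    (hX : ∀ x ∈ X, IsDead e x) (hm : Set.InjOn (m • ·) Xᶜ) :
    ∃ u ∈ transps (Set.univ : Set I), (∀ x ∉ X, u • x = m • x) ∧ m * e = u * e := by
  induction m using induction_left with
  | one => exact ⟨1, one_mem _, by simp, by simp⟩
  | transp_mul i j m ih =>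
    obtain ⟨u, hu, hum, he⟩ := ih fun x hx y hy hxy => hm hx hy (by simp only [mul_smul, hxy])
    refine ⟨transpUnit i j * u, mul_mem (transpUnit_mem_transps trivial trivial) hu, ?_, ?_⟩
    · intro x hx
      rw [mul_smul, mul_smul, hum x hx, transpUnit_smul, transp_smul]
    · rw [mul_assoc, he, Units.val_mul, val_transpUnit, mul_assoc]
  | repl_mul a b m ih =>
    obtain ⟨u, hu, hum, he⟩ := ih fun x hx y hy hxy => hm hx hy (by simp only [mul_smul, hxy])
    obtain ⟨v, hv, hvu, hve⟩ := exists_mem_transps_repl_mul_eq_mul (a := a) (b := b) hu hX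
      fun x hx y hy hxy => hm hx hy (by simpa only [mul_smul, hum x hx, hum y hy] using hxy)
    exact ⟨v, hv, fun x hx => by rw [hvu x hx, hum x hx, mul_smul], by rw [mul_assoc, he, hve]⟩

theorem toMap_injective [Infinite I] : Function.Injective (toMap (I := I)) := by
  intro m₁ m₂ h
  have hsmul (x : I) : m₁ • x = m₂ • x := congrFun h x
  obtain ⟨e, X, hX, hinj, he⟩ := exists_isDead_injOn_mul_eq_self m₁
  obtain ⟨u₁, hu₁, hu₁m, h₁⟩ := exists_mem_transps_mul_eq_mul m₁ hX hinj
  obtain ⟨u₂, hu₂, hu₂m, h₂⟩ :=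
    exists_mem_transps_mul_eq_mul m₂ hX (by simpa only [hsmul] using hinj)
  have hu : u₂⁻¹ * u₁ ∈ transps X :=
    mem_transps_of_forall_smul_eq (mul_mem (inv_mem hu₂) hu₁) fun x hx => by
      rw [mul_smul, hu₁m x hx, hsmul, ← hu₂m x hx, inv_smul_smul]
  calc m₁ = u₁ * e := by rw [← h₁, he m₁ fun _ _ => id]
    _ = u₂ * ((u₂⁻¹ * u₁ : (SubstMonoid I)ˣ) * e) := by
      rw [Units.val_mul, mul_assoc, Units.mul_inv_cancel_left]
    _ = u₂ * e := by rw [mul_eq_self_of_mem_transps hX hu]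
    _ = m₂ := by
      rw [← h₂, he m₂ fun x y hxy => (by rwa [← hsmul, ← hsmul] : m₂ • x = m₂ • y)]

end SubstMonoid

/-! ### Boolean prime ideals -/

section Ultrafilters

open Order

variable {α β γ : Type*}

/-- Homomorphisms to `Prop` play the role of ultrafilters: `φ` stands for `{a | φ a}`. -/
theorem exists_hom_of_disjoint [DistribLattice α] [BoundedOrder α] {F : PFilter α} {J : Ideal α}
    (h : Disjoint (F : Set α) J) :
    ∃ φ : BoundedLatticeHom α Prop, (∀ a ∈ F, φ a) ∧ ∀ a ∈ J, ¬ φ a := by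
  obtain ⟨K, hK, hJK, hFK⟩ := DistribLattice.prime_ideal_of_disjoint_filter_ideal h
  let φ : BoundedLatticeHom α Prop :=
    { toFun := fun a => a ∉ K
      map_sup' := fun a b => by simp only [Ideal.sup_mem_iff, not_and_or, sup_Prop_eq]
      map_inf' := fun a b => by
        simp only [inf_Prop_eq, ← not_or, eq_iff_iff, not_iff_not]
        exact ⟨hK.mem_or_mem,
          Or.rec (fun ha => K.lower inf_le_left ha) fun hb => K.lower inf_le_right hb⟩
      map_top' := eq_true hK.toIsProper.top_notMem
      map_bot' := eq_false (not_not_intro K.bot_mem) }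
  exact ⟨φ, fun a ha => Set.disjoint_left.1 hFK ha, fun a ha => not_not_intro (hJK ha)⟩

theorem eq_of_forall_hom_prop_iff [DistribLattice α] [BoundedOrder α] {a b : α}
    (h : ∀ φ : BoundedLatticeHom α Prop, φ a ↔ φ b) : a = b := by
  have le_of_imp {a b : α} (h : ∀ φ : BoundedLatticeHom α Prop, φ a → φ b) : a ≤ b := by
    by_contra hab
    obtain ⟨φ, hφ, hφ'⟩ := exists_hom_of_disjoint (F := PFilter.principal a)
      (J := Ideal.principal b) (Set.disjoint_left.2 fun x hax hxb => hab (le_trans hax hxb))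
    exact hφ' b (by simp) (h φ (hφ a (by simp)))
  exact le_antisymm (le_of_imp fun φ => (h φ).1) (le_of_imp fun φ => (h φ).2)

variable [BooleanAlgebra α]

theorem exists_comp_eq_and_not [DistribLattice γ] [BoundedOrder γ] (π : BoundedLatticeHom α Prop)
    (g : BoundedLatticeHom α γ) {c : γ} (h : ∀ a, g a ≤ c → ¬ π a) :
    ∃ ψ : BoundedLatticeHom γ Prop, ψ.comp g = π ∧ ¬ ψ c := by
  have isPFilter : IsPFilter {y : γ | ∃ a, π a ∧ g a ≤ y} := by
    refine IsPFilter.of_def ⟨⊤, ⊤, by simp, le_top⟩ ?_ fun {x y} hxy => ?_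
    · rintro x ⟨a, ha, hax⟩ y ⟨b, hb, hby⟩
      refine ⟨x ⊓ y, ⟨a ⊓ b, by rw [map_inf]; exact ⟨ha, hb⟩, ?_⟩, inf_le_left, inf_le_right⟩
      rw [map_inf]
      exact inf_le_inf hax hby
    · rintro ⟨a, ha, hax⟩
      exact ⟨a, ha, hax.trans hxy⟩
  obtain ⟨ψ, hψ, hψc⟩ := exists_hom_of_disjoint (F := isPFilter.toPFilter)
    (J := Ideal.principal c) <| Set.disjoint_left.2 fun y ⟨a, ha, hay⟩ hyc =>
      h a (hay.trans hyc) ha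
  have of_prop {a : α} (ha : π a) : ψ (g a) := hψ _ ⟨a, ha, le_rfl⟩
  refine ⟨ψ, BoundedLatticeHom.ext fun a => propext ⟨fun ha => ?_, of_prop⟩, hψc c (by simp)⟩
  by_contra hna
  have hbot : ψ (g (a ⊓ aᶜ)) := by
    rw [map_inf, map_inf]
    exact ⟨ha, of_prop (by rwa [map_compl'])⟩
  simp at hbot

theorem exists_comp_eq_of_injective [DistribLattice γ] [BoundedOrder γ]
    (π : BoundedLatticeHom α Prop) {g : BoundedLatticeHom α γ} (hg : Function.Injective g) :
    ∃ ψ : BoundedLatticeHom γ Prop, ψ.comp g = π := by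
  obtain ⟨ψ, hψ, -⟩ := exists_comp_eq_and_not π g (c := ⊥) fun a ha => by
    rw [hg ((le_bot_iff.1 ha).trans (map_bot g).symm), map_bot]
    exact id
  exact ⟨ψ, hψ⟩

theorem exists_comp_eq_and [BooleanAlgebra β] (π : BoundedLatticeHom α Prop)
    (f : BoundedLatticeHom α β) {b : β} (h : ∀ a, b ≤ f a → π a) :
    ∃ φ : BoundedLatticeHom β Prop, φ.comp f = π ∧ φ b := by
  obtain ⟨φ, hφ, hb⟩ := exists_comp_eq_and_not π f (c := bᶜ) fun a ha => by
    have := h aᶜ (by rwa [map_compl', le_compl_comm])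
    rwa [map_compl'] at this
  exact ⟨φ, hφ, by rw [map_compl'] at hb; exact not_not.1 hb⟩

theorem exists_comp_eq_comp_of_not_exists_between [BooleanAlgebra β] [DistribLattice γ]
    [BoundedOrder γ] (f : BoundedLatticeHom α β) (g : BoundedLatticeHom α γ) {b : β} {c : γ}
    (h : ¬ ∃ a, b ≤ f a ∧ g a ≤ c) :
    ∃ (φ : BoundedLatticeHom β Prop) (ψ : BoundedLatticeHom γ Prop),
      φ.comp f = ψ.comp g ∧ φ b ∧ ¬ ψ c := by
  have isPFilter : IsPFilter {a | b ≤ f a} :=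
    IsPFilter.of_def ⟨⊤, by simp⟩
      (fun x hx y hy => ⟨x ⊓ y, by simpa using ⟨hx, hy⟩, inf_le_left, inf_le_right⟩)
      fun {x y} hxy hx => le_trans hx (OrderHomClass.mono f hxy)
  have isIdeal : IsIdeal {a | g a ≤ c} :=
    { IsLowerSet := fun x y hyx hx => le_trans (OrderHomClass.mono g hyx) hx
      Nonempty := ⟨⊥, by simp⟩
      Directed := fun x hx y hy => ⟨x ⊔ y, by simpa using ⟨hx, hy⟩, le_sup_left, le_sup_right⟩ }
  obtain ⟨π, hπb, hπc⟩ := exists_hom_of_disjoint (F := isPFilter.toPFilter) (J := isIdeal.toIdeal)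
    (Set.disjoint_left.2 fun a hb hc => h ⟨a, hb, hc⟩)
  obtain ⟨φ, hφ, hb⟩ := exists_comp_eq_and π f hπb
  obtain ⟨ψ, hψ, hc⟩ := exists_comp_eq_and_not π g hπc
  exact ⟨φ, ψ, hφ.trans hψ.symm, hb, hc⟩

end Ultrafilters

/-! ### Algebras and their homomorphisms -/

section Operations

open FirstOrder.Language FirstOrder.Language.Structure

variable {A B : Alg.{u} I}

/-- The operation `·` of an algebra. -/
def meetOp (a b : A) : A := funMap (L := lang I) (n := 2) Op.meet ![a, b]

/-- The operation `-` of an algebra. -/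
def complOp (a : A) : A := funMap (L := lang I) (n := 1) Op.compl ![a]

/-- The operation `+` of an algebra, an abbreviation of `-(-x · -y)`. -/
def joinOp (a b : A) : A := complOp (meetOp (complOp a) (complOp b))

open Classical in
/-- The operation of an algebra that a generator names: `sⁱⱼ` for `repl i j`, and `s_ij` for
`transp i j`. On the diagonal, where there is no such operation, it is the identity. -/
noncomputable def Gen.op (A : Alg.{u} I) : Gen I → A → A
  | .repl i j, a => if h : i = j then a else funMap (L := lang I) (n := 1) (Op.repl i j h) ![a]
  | .transp i j, a => if h : i = j then a else funMap (L := lang I) (n := 1) (Op.transp i j h) ![a]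

theorem Gen.op_repl_self (i : I) (a : A) : (Gen.repl i i).op A a = a := dif_pos rfl

theorem Gen.op_transp_self (i : I) (a : A) : (Gen.transp i i).op A a = a := dif_pos rfl

theorem Gen.op_repl {i j : I} (h : i ≠ j) (a : A) :
    (Gen.repl i j).op A a = funMap (L := lang I) (n := 1) (Op.repl i j h) ![a] := dif_neg h

theorem Gen.op_transp {i j : I} (h : i ≠ j) (a : A) :
    (Gen.transp i j).op A a = funMap (L := lang I) (n := 1) (Op.transp i j h) ![a] := dif_neg h

theorem realize_meet (s t : Tm I) (v : ℕ → A) :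
    (s.meet t).realize v = meetOp (s.realize v) (t.realize v) :=
  Term.realize_functions_apply₂

theorem realize_neg (t : Tm I) (v : ℕ → A) : t.neg.realize v = complOp (t.realize v) :=
  Term.realize_functions_apply₁

theorem realize_join (s t : Tm I) (v : ℕ → A) :
    (s.join t).realize v = joinOp (s.realize v) (t.realize v) := by
  simp only [Tm.join, joinOp, realize_meet, realize_neg]

theorem realize_repl (i j : I) (h : i ≠ j) (t : Tm I) (v : ℕ → A) :
    (t.repl i j h).realize v = (Gen.repl i j).op A (t.realize v) :=
  Term.realize_functions_apply₁.trans (Gen.op_repl h _).symm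

theorem realize_transp (i j : I) (h : i ≠ j) (t : Tm I) (v : ℕ → A) :
    (t.transp i j h).realize v = (Gen.transp i j).op A (t.realize v) :=
  Term.realize_functions_apply₁.trans (Gen.op_transp h _).symm

theorem map_meetOp (f : A →[lang I] B) (a b : A) : f (meetOp a b) = meetOp (f a) (f b) :=
  (f.map_fun Op.meet _).trans (congrArg _ (FinVec.map_eq f ![a, b]).symm)

theorem map_complOp (f : A →[lang I] B) (a : A) : f (complOp a) = complOp (f a) :=
  (f.map_fun Op.compl _).trans (congrArg _ (FinVec.map_eq f ![a]).symm)

theorem map_joinOp (f : A →[lang I] B) (a b : A) : f (joinOp a b) = joinOp (f a) (f b) := by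
  simp only [joinOp, map_meetOp, map_complOp]

theorem map_op (f : A →[lang I] B) (g : Gen I) (a : A) : f (g.op A a) = g.op B (f a) := by
  obtain ⟨i, j⟩ | ⟨i, j⟩ := g <;> obtain rfl | h := eq_or_ne i j
  · simp only [Gen.op_repl_self]
  · rw [Gen.op_repl h, Gen.op_repl h]
    exact (f.map_fun (Op.repl i j h) _).trans (congrArg _ (FinVec.map_eq f ![a]).symm)
  · simp only [Gen.op_transp_self]
  · rw [Gen.op_transp h, Gen.op_transp h]
    exact (f.map_fun (Op.transp i j h) _).trans (congrArg _ (FinVec.map_eq f ![a]).symm)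

/-- The homomorphism given by a map that preserves the operations. -/
def homOfOps (f : A → B) (hmeet : ∀ a b, f (meetOp a b) = meetOp (f a) (f b))
    (hcompl : ∀ a, f (complOp a) = complOp (f a)) (hop : ∀ g a, f (Gen.op A g a) = g.op B (f a)) :
    A →[lang I] B where
  toFun := f
  map_fun' := fun {n} o x => by
    rw [← FinVec.map_eq, ← FinVec.etaExpand_eq x]
    cases o with
    | meet => exact hmeet _ _
    | compl => exact hcompl _
    | repl i j h => exact Gen.op_repl h (x 0) ▸ Gen.op_repl h (f (x 0)) ▸ hop (.repl i j) (x 0)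
    | transp i j h =>
      exact Gen.op_transp h (x 0) ▸ Gen.op_transp h (f (x 0)) ▸ hop (.transp i j) (x 0)
  map_rel' := fun r _ => r.elim

/-- The projections of a direct product. -/
def projHom {J : Type u} (A : J → Alg.{u} I) (j : J) : prod A →[lang I] A j where
  toFun a := a j
  map_fun' _ _ := rfl
  map_rel' r _ := r.elim

/-- The homomorphism to a direct product with given components. -/
def prodHom {J : Type u} {B : J → Alg.{u} I} (f : ∀ j, A →[lang I] B j) : A →[lang I] prod B where
  toFun a j := f j a
  map_fun' o x := funext fun j => (f j).map_fun o x
  map_rel' r _ := r.elim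

theorem isVariety_Mod (E : Set (Tm I × Tm I)) : IsVariety (Mod E) where
  image A hA B f hf e he v := by
    obtain ⟨w, rfl⟩ := hf.comp_left v
    rw [HomClass.realize_term, HomClass.realize_term, hA e he]
  sub B hB A f hf e he v := hf <| by
    rw [← HomClass.realize_term, ← HomClass.realize_term, hB e he]
  prod J A hA e he v := funext fun j => by
    change projHom A j _ = projHom A j _
    rw [← HomClass.realize_term, ← HomClass.realize_term, hA j e he]

end Operations

/-! ### The action of the substitution monoid on a member of `SA` -/

section Boolean

variable {A B : Alg.{u} I}

/-- The valuation of the variables `v₀`, `v₁` and `v₂`. -/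
def val (a b c : A) : ℕ → A
  | 0 => a
  | 1 => b
  | _ => c

theorem realize_x (a b c : A) : (Tm.x : Tm I).realize (val a b c) = a := rfl

theorem realize_y (a b c : A) : (Tm.y : Tm I).realize (val a b c) = b := rfl

theorem realize_z (a b c : A) : (Tm.z : Tm I).realize (val a b c) = c := rfl

theorem Ax.realize_eq [hA : Fact (A ∈ SA I)] {s t : Tm I} (h : Ax I s t) (v : ℕ → A) :
    s.realize v = t.realize v := hA.out (s, t) h v

variable [Fact (A ∈ SA I)] [Fact (B ∈ SA I)]

theorem joinOp_comm (a b : A) : joinOp a b = joinOp b a := by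
  simpa only [realize_join, realize_x, realize_y] using
    Ax.join_comm.realize_eq (val a b b)

theorem joinOp_assoc (a b c : A) : joinOp (joinOp a b) c = joinOp a (joinOp b c) := by
  simpa only [realize_join, realize_x, realize_y, realize_z] using
    (Ax.join_assoc.realize_eq (val a b c)).symm

theorem meetOp_comm (a b : A) : meetOp a b = meetOp b a := by
  simpa only [realize_meet, realize_x, realize_y] using
    Ax.meet_comm.realize_eq (val a b b)

theorem meetOp_assoc (a b c : A) : meetOp (meetOp a b) c = meetOp a (meetOp b c) := by
  simpa only [realize_meet, realize_x, realize_y, realize_z] using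
    (Ax.meet_assoc.realize_eq (val a b c)).symm

theorem joinOp_meetOp_self (a b : A) : joinOp a (meetOp a b) = a := by
  simpa only [realize_meet, realize_join, realize_x, realize_y] using
    Ax.join_meet_absorb.realize_eq (val a b b)

theorem meetOp_joinOp_self (a b : A) : meetOp a (joinOp a b) = a := by
  simpa only [realize_meet, realize_join, realize_x, realize_y] using
    Ax.meet_join_absorb.realize_eq (val a b b)

theorem meetOp_joinOp (a b c : A) : meetOp a (joinOp b c) = joinOp (meetOp a b) (meetOp a c) := by
  simpa only [realize_meet, realize_join, realize_x, realize_y, realize_z] using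
    Ax.meet_join_distrib.realize_eq (val a b c)

theorem joinOp_meetOp_complOp (a b : A) : joinOp a (meetOp b (complOp b)) = a := by
  simpa only [Tm.zero, realize_meet, realize_neg, realize_join, realize_x, realize_y] using
    Ax.join_zero.realize_eq (val b a a)

theorem meetOp_joinOp_complOp (a b : A) : meetOp a (joinOp b (complOp b)) = a := by
  simpa only [Tm.one, realize_meet, realize_neg, realize_join, realize_x, realize_y] using
    Ax.meet_one.realize_eq (val b a a)

instance : DistribLattice A :=
  letI : Max A := ⟨joinOp⟩
  letI : Min A := ⟨meetOp⟩
  letI : Lattice A := Lattice.mk' joinOp_comm joinOp_assoc meetOp_comm meetOp_assoc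
    joinOp_meetOp_self meetOp_joinOp_self
  DistribLattice.ofInfSupLe fun a b c => (meetOp_joinOp a b c).le

noncomputable instance : BooleanAlgebra A where
  compl := complOp
  bot := meetOp (A := A) (Classical.arbitrary A) (complOp (Classical.arbitrary A))
  top := joinOp (A := A) (Classical.arbitrary A) (complOp (Classical.arbitrary A))
  inf_compl_le_bot a := sup_eq_left.1 (joinOp_meetOp_complOp _ a)
  top_le_sup_compl a := inf_eq_left.1 (meetOp_joinOp_complOp _ a)
  le_top a := inf_eq_left.1 (meetOp_joinOp_complOp a _)
  bot_le a := sup_eq_left.1 (joinOp_meetOp_complOp a _)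

theorem le_iff_le (a b : A) : le a b ↔ a ≤ b := inf_eq_left (a := a) (b := b)

theorem meetOp_complOp_self (a : A) : meetOp a (complOp a) = ⊥ := inf_compl_self a

theorem joinOp_complOp_self (a : A) : joinOp a (complOp a) = ⊤ := sup_compl_eq_top (x := a)

/-- A homomorphism between members of `SA`, as a Boolean homomorphism. -/
noncomputable def toBoolHom (f : A →[lang I] B) : BoundedLatticeHom A B where
  toFun := f
  map_sup' := map_joinOp f
  map_inf' := map_meetOp f
  map_top' := by
    rw [← joinOp_complOp_self (Classical.arbitrary A), map_joinOp, map_complOp, joinOp_complOp_self]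
  map_bot' := by
    rw [← meetOp_complOp_self (Classical.arbitrary A), map_meetOp, map_complOp, meetOp_complOp_self]

theorem Gen.op_meetOp (g : Gen I) (a b : A) :
    g.op A (meetOp a b) = meetOp (g.op A a) (g.op A b) := by
  obtain ⟨i, j⟩ | ⟨i, j⟩ := g <;> obtain rfl | h := eq_or_ne i j
  · simp only [Gen.op_repl_self]
  · simpa only [realize_repl, realize_meet, realize_x, realize_y] using
      (Ax.repl_meet i j h).realize_eq (val a b b)
  · simp only [Gen.op_transp_self]
  · simpa only [realize_transp, realize_meet, realize_x, realize_y] using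
      (Ax.transp_meet i j h).realize_eq (val a b b)

theorem Gen.op_joinOp (g : Gen I) (a b : A) :
    g.op A (joinOp a b) = joinOp (g.op A a) (g.op A b) := by
  obtain ⟨i, j⟩ | ⟨i, j⟩ := g <;> obtain rfl | h := eq_or_ne i j
  · simp only [Gen.op_repl_self]
  · simpa only [realize_repl, realize_join, realize_x, realize_y] using
      (Ax.repl_join i j h).realize_eq (val a b b)
  · simp only [Gen.op_transp_self]
  · simpa only [realize_transp, realize_join, realize_x, realize_y] using
      (Ax.transp_join i j h).realize_eq (val a b b)

theorem Gen.op_bot (g : Gen I) :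
    g.op A ⊥ = ⊥ := by
  obtain ⟨i, j⟩ | ⟨i, j⟩ := g <;> obtain rfl | h := eq_or_ne i j
  · simp only [Gen.op_repl_self]
  · simpa only [realize_repl, Tm.zero, realize_meet, realize_neg, realize_x,
      meetOp_complOp_self] using
      (Ax.repl_zero i j h).realize_eq (val (⊥ : A) ⊥ ⊥)
  · simp only [Gen.op_transp_self]
  · simpa only [realize_transp, Tm.zero, realize_meet, realize_neg, realize_x,
      meetOp_complOp_self] using
      (Ax.transp_zero i j h).realize_eq (val (⊥ : A) ⊥ ⊥)

theorem Gen.op_top (g : Gen I) :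
    g.op A ⊤ = ⊤ := by
  obtain ⟨i, j⟩ | ⟨i, j⟩ := g <;> obtain rfl | h := eq_or_ne i j
  · simp only [Gen.op_repl_self]
  · simpa only [realize_repl, Tm.one, realize_join, realize_neg, realize_x,
      joinOp_complOp_self] using
      (Ax.repl_one i j h).realize_eq (val (⊥ : A) ⊥ ⊥)
  · simp only [Gen.op_transp_self]
  · simpa only [realize_transp, Tm.one, realize_join, realize_neg, realize_x,
      joinOp_complOp_self] using
      (Ax.transp_one i j h).realize_eq (val (⊥ : A) ⊥ ⊥)

variable (A) in
/-- The Boolean endomorphism that a generator names. -/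
noncomputable def Gen.hom (g : Gen I) : BoundedLatticeHom A A where
  toFun := g.op A
  map_sup' := g.op_joinOp
  map_inf' := g.op_meetOp
  map_top' := g.op_top
  map_bot' := g.op_bot

theorem Gen.hom_apply (g : Gen I) (a : A) : g.hom A a = g.op A a := rfl

instance {α : Type*} [Lattice α] [BoundedOrder α] : Monoid (BoundedLatticeHom α α) where
  mul := BoundedLatticeHom.comp
  mul_assoc _ _ _ := rfl
  one := BoundedLatticeHom.id α
  one_mul _ := rfl
  mul_one _ := rfl

theorem boolEnd_mul_apply {α : Type*} [Lattice α] [BoundedOrder α] (f g : BoundedLatticeHom α α)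
    (a : α) : (f * g) a = f (g a) := rfl

theorem boolEnd_one_apply {α : Type*} [Lattice α] [BoundedOrder α] (a : α) :
    (1 : BoundedLatticeHom α α) a = a := rfl

attribute [local simp] realize_repl realize_transp realize_x boolEnd_mul_apply boolEnd_one_apply
  Gen.hom_apply in
theorem lift_hom_eq {v w : FreeMonoid (Gen I)} (h : SubstRel v w) :
    FreeMonoid.lift (Gen.hom A) v = FreeMonoid.lift (Gen.hom A) w := by
  refine DFunLike.ext _ _ fun a => ?_
  have ax {s t : Tm I} (h : Ax I s t) : s.realize (val a a a) = t.realize (val a a a) :=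
    h.realize_eq _
  cases h with
  | repl_self i => exact Gen.op_repl_self i a
  | transp_self i => exact Gen.op_transp_self i a
  | transp_symm i j h => simpa using ax (.transp_symm i j h)
  | transp_transp i j h => simpa using ax (.transp_transp i j h)
  | transp_conj i j k hij hik hjk => simpa using ax (.transp_conj i j k hij hik hjk)
  | transp_comm i j k l hij hik hil hjk hjl hkl =>
      simpa using ax (.transp_comm i j k l hij hik hil hjk hjl hkl)
  | conj_disjoint i j k l hij hik hil hjk hjl hkl =>
      simpa using ax (.conj_disjoint i j k l hij hik hil hjk hjl hkl)
  | conj_upper i j k hij hik hjk => simpa using ax (.conj_upper i j k hij hik hjk)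
  | conj_lower i j k hij hik hjk => simpa using ax (.conj_lower i j k hij hik hjk)
  | conj_both i j h => simpa using ax (.conj_both i j h)
  | repl_comm_disjoint i j k l hij hik hil hjk hjl hkl =>
      simpa using ax (.repl_comm_disjoint i j k l hij hik hil hjk hjl hkl)
  | repl_comm_lower i j k hij hik hjk => simpa using ax (.repl_comm_lower i j k hij hik hjk)
  | repl_chain i j k hij hik hjk => simpa using ax (.repl_chain i j k hij hik hjk)
  | repl_repl_transp i j k hij hik hjk => simpa using ax (.repl_repl_transp i j k hij hik hjk)
  | repl_upper i j k hij hik hjk => simpa using ax (.repl_upper i j k hij hik hjk)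
  | repl_idem i j h => simpa using ax (.repl_idem i j h)
  | repl_swap i j h => simpa using ax (.repl_swap i j h)
  | repl_transp i j h => simpa using ax (.repl_transp i j h)

variable (A) in
/-- The action of the substitution monoid on a member of `SA` by Boolean endomorphisms. -/
noncomputable def act : SubstMonoid I →* BoundedLatticeHom A A :=
  PresentedMonoid.lift (Gen.hom A) fun _ _ => lift_hom_eq

theorem toBoolHom_comp_act (f : A →[lang I] B) (m : SubstMonoid I) :
    (toBoolHom f).comp (act A m) = (act B m).comp (toBoolHom f) := by
  refine DFunLike.ext _ _ fun a => ?_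
  change f (act A m a) = act B m (f a)
  induction m using SubstMonoid.induction_left with
  | one => rw [map_one, map_one, boolEnd_one_apply, boolEnd_one_apply]
  | repl_mul i j m ih =>
    rw [map_mul, map_mul, boolEnd_mul_apply, boolEnd_mul_apply, ← ih]
    exact map_op f (.repl i j) _
  | transp_mul i j m ih =>
    rw [map_mul, map_mul, boolEnd_mul_apply, boolEnd_mul_apply, ← ih]
    exact map_op f (.transp i j) _

end Boolean

/-! ### Complex algebras of right actions -/

section ComplexAlg

open MulOpposite SubstMonoid
open scoped RightActions

variable {X : Type u} [MulAction (SubstMonoid I)ᵐᵒᵖ X]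

/-- The operations of the complex algebra of a right action. -/
def complexOp (X : Type u) [MulAction (SubstMonoid I)ᵐᵒᵖ X] :
    {n : ℕ} → Op I n → (Fin n → Set X) → Set X
  | _, .meet, Y => Y 0 ∩ Y 1
  | _, .compl, Y => (Y 0)ᶜ
  | _, .repl i j _, Y => {x | x <• repl i j ∈ Y 0}
  | _, .transp i j _, Y => {x | x <• transp i j ∈ Y 0}

variable (I X) in
/-- The complex algebra of a right action of the substitution monoid: its elements are the sets of
points, and `sⁱⱼ Y` is the set of points that `[i|j]` takes into `Y`. -/
def complexAlg : Alg.{u} I where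
  carrier := Set X
  nonempty := ⟨(∅ : Set X)⟩
  str :=
    { funMap := fun f Y => complexOp X f Y
      RelMap := fun r _ => r.elim }

instance : Membership X (complexAlg I X) := inferInstanceAs (Membership X (Set X))

section Mem

variable {x : X} {Y Z : complexAlg I X}

theorem mem_meetOp : x ∈ meetOp Y Z ↔ x ∈ Y ∧ x ∈ Z := Iff.rfl

theorem mem_complOp : x ∈ complOp Y ↔ x ∉ Y := Iff.rfl

theorem mem_joinOp : x ∈ joinOp Y Z ↔ x ∈ Y ∨ x ∈ Z := by
  rw [joinOp, mem_complOp, mem_meetOp, mem_complOp, mem_complOp, or_iff_not_and_not]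

theorem mem_op_repl {i j : I} :
    x ∈ (Gen.repl i j).op (complexAlg I X) Y ↔ x <• repl i j ∈ Y := by
  obtain rfl | h := eq_or_ne i j
  · rw [Gen.op_repl_self, repl_self, op_one, one_smul]
  · rw [Gen.op_repl h]
    rfl

theorem mem_op_transp {i j : I} :
    x ∈ (Gen.transp i j).op (complexAlg I X) Y ↔ x <• transp i j ∈ Y := by
  obtain rfl | h := eq_or_ne i j
  · rw [Gen.op_transp_self, transp_self, op_one, one_smul]
  · rw [Gen.op_transp h]
    rfl

end Mem

theorem complexAlg_ext {Y Z : complexAlg I X} (h : ∀ x : X, x ∈ Y ↔ x ∈ Z) : Y = Z := Set.ext h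

theorem complexAlg_le_iff {Y Z : complexAlg I X} : le Y Z ↔ ∀ x : X, x ∈ Y → x ∈ Z :=
  Set.inter_eq_left

theorem complexAlg_mem_SA : complexAlg I X ∈ SA I := by
  rintro ⟨s, t⟩ (h : Ax I s t) v
  refine complexAlg_ext fun x => ?_
  have of_rel {p q : FreeMonoid (Gen I)} (h : SubstRel p q) :
      x <• PresentedMonoid.mk SubstRel p ∈ v 0 ↔ x <• PresentedMonoid.mk SubstRel q ∈ v 0 := by
    rw [mk_eq_mk h]
  dsimp only
  cases h <;> simp only [Tm.zero, Tm.one, realize_meet, realize_neg, realize_join, realize_repl,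
    realize_transp, mem_meetOp, mem_complOp, mem_joinOp, mem_op_repl, mem_op_transp,
    op_smul_op_smul]
  case transp_symm i j h => exact of_rel (.transp_symm i j h)
  case transp_transp i j h => rw [transp_mul_self, op_one, one_smul]
  case transp_conj i j k hij hik hjk => exact of_rel (.transp_conj i j k hij hik hjk)
  case transp_comm i j k l hij hik hil hjk hjl hkl =>
    exact of_rel (.transp_comm i j k l hij hik hil hjk hjl hkl)
  case conj_disjoint i j k l hij hik hil hjk hjl hkl =>
    exact of_rel (.conj_disjoint i j k l hij hik hil hjk hjl hkl)
  case conj_upper i j k hij hik hjk => exact of_rel (.conj_upper i j k hij hik hjk)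
  case conj_lower i j k hij hik hjk => exact of_rel (.conj_lower i j k hij hik hjk)
  case conj_both i j h => exact of_rel (.conj_both i j h)
  case repl_comm_disjoint i j k l hij hik hil hjk hjl hkl =>
    exact of_rel (.repl_comm_disjoint i j k l hij hik hil hjk hjl hkl)
  case repl_comm_lower i j k hij hik hjk => exact of_rel (.repl_comm_lower i j k hij hik hjk)
  case repl_chain i j k hij hik hjk => exact of_rel (.repl_chain i j k hij hik hjk)
  case repl_repl_transp i j k hij hik hjk => exact of_rel (.repl_repl_transp i j k hij hik hjk)
  case repl_upper i j k hij hik hjk => exact of_rel (.repl_upper i j k hij hik hjk)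
  case repl_idem i j h => exact of_rel (.repl_idem i j h)
  case repl_swap i j h => exact of_rel (.repl_swap i j h)
  case repl_transp i j h => exact of_rel (.repl_transp i j h)
  all_goals tauto

section EvalHom

variable {A : Alg.{u} I} [Fact (A ∈ SA I)]

/-- The homomorphism to a complex algebra that an equivariant family of ultrafilters, indexed by the
points of the action, gives. -/
noncomputable def evalHom (F : X → BoundedLatticeHom A Prop)
    (hF : ∀ x m, F (x <• m) = (F x).comp (act A m)) : A →[lang I] complexAlg I X :=
  homOfOps (fun a => {x | F x a})
    (fun a b => complexAlg_ext fun x => iff_of_eq (map_inf (F x) a b))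
    (fun a => complexAlg_ext fun x => iff_of_eq (map_compl' (F x) a))
    (fun g a => complexAlg_ext fun x => by
      obtain ⟨i, j⟩ | ⟨i, j⟩ := g
      · exact (mem_op_repl.trans (iff_of_eq (DFunLike.congr_fun (hF x (repl i j)) a))).symm
      · exact (mem_op_transp.trans (iff_of_eq (DFunLike.congr_fun (hF x (transp i j)) a))).symm)

end EvalHom

/-! ### Representation by set algebras -/

section SetAlg

variable {V : Set (I → I)}

theorem toMap_mul (m n : SubstMonoid I) : toMap (m * n) = toMap m ∘ toMap n := map_mul toMap m n

theorem LocallySquare.comp_toMap_mem (hV : LocallySquare V) {q : I → I} (hq : q ∈ V)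
    (m : SubstMonoid I) : q ∘ toMap m ∈ V := by
  induction m using SubstMonoid.induction_right with
  | one => exact hq
  | mul_repl m i j ih =>
    rw [toMap_mul]
    exact (hV _ ih i j).1
  | mul_transp m i j ih =>
    rw [toMap_mul]
    exact (hV _ ih i j).2

/-- The right action of the substitution monoid on a locally square set, by composition. -/
noncomputable abbrev LocallySquare.mulAction (hV : LocallySquare V) :
    MulAction (SubstMonoid I)ᵐᵒᵖ V where
  smul m q := ⟨q ∘ toMap m.unop, hV.comp_toMap_mem q.2 m.unop⟩
  one_smul _ := Subtype.ext rfl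
  mul_smul m n q := Subtype.ext <| by
    change (q : I → I) ∘ toMap (n.unop * m.unop) = _
    rw [toMap_mul]
    rfl

theorem mem_setSubst {σ : I → I} {q : V} (hq : (q : I → I) ∘ σ ∈ V) {Y : Set V} :
    q ∈ setSubst σ Y ↔ ⟨q ∘ σ, hq⟩ ∈ Y :=
  ⟨fun ⟨_, hp, h⟩ => by simpa only [← h] using hp, fun h => ⟨_, h, rfl⟩⟩

theorem setAlg_eq_complexAlg (hV : LocallySquare V) :
    setAlg V = @complexAlg I V hV.mulAction := by
  have setOp_eq {n : ℕ} (o : Op I n) (Y : Fin n → Set V) :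
      setOp V o Y = @complexOp I V hV.mulAction n o Y := by
    cases o with
    | meet => rfl
    | compl => rfl
    | repl i j => exact Set.ext fun q => mem_setSubst (hV q q.2 i j).1
    | transp i j => exact Set.ext fun q => mem_setSubst (hV q q.2 i j).2
  unfold setAlg complexAlg
  congr 2
  funext n o Y
  exact setOp_eq o Y

theorem WSA_subset_SA : WSA I ⊆ SA I :=
  Set.sInter_subset_of_mem ⟨isVariety_Mod _, fun _ ⟨_, _, hV, h⟩ => by
    rw [h, setAlg_eq_complexAlg hV]
    let _ := hV.mulAction
    exact complexAlg_mem_SA⟩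

theorem finite_smul_ne (m : SubstMonoid I) : {x : I | m • x ≠ x}.Finite := by
  classical
  induction m using SubstMonoid.induction_right with
  | one => simp
  | mul_repl m i j ih =>
    refine (ih.union (Set.toFinite {i})).subset fun x hx => ?_
    rw [Set.mem_ofPred_eq, mul_smul, repl_smul, replMap_apply] at hx
    grind
  | mul_transp m i j ih =>
    refine (ih.union (Set.toFinite {i, j})).subset fun x hx => ?_
    rw [Set.mem_ofPred_eq, mul_smul, transp_smul, transpMap_apply] at hx
    grind

variable (I) in
/-- The transformations of `I` that are products of replacements and transpositions. -/
def substMaps : Set (I → I) := Set.range toMap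

theorem substMaps_subset_weakSet : substMaps I ⊆ weakSet I := by
  rintro _ ⟨m, rfl⟩
  exact finite_smul_ne m

theorem locallySquare_substMaps : LocallySquare (substMaps I) := by
  rintro _ ⟨m, rfl⟩ i j
  exact ⟨⟨m * repl i j, toMap_mul ..⟩, ⟨m * transp i j, toMap_mul ..⟩⟩

variable (I) in
/-- The substitution monoid of an infinite set, represented faithfully by transformations. -/
noncomputable def equivSubstMaps [Infinite I] : SubstMonoid I ≃ substMaps I :=
  Equiv.ofInjective toMap toMap_injective

theorem SA_subset_WSA [Infinite I] : SA I ⊆ WSA I := by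
  rintro A hA W ⟨hW, hK⟩
  have : Fact (A ∈ SA I) := ⟨hA⟩
  have hV := locallySquare_substMaps (I := I)
  let _ := hV.mulAction
  let e := equivSubstMaps I
  have symm_smul (v : substMaps I) (m : SubstMonoid I) : e.symm (v <• m) = e.symm v * m := by
    obtain ⟨n, rfl⟩ := e.surjective v
    rw [e.symm_apply_apply, Equiv.symm_apply_eq]
    exact Subtype.ext (toMap_mul n m).symm
  let f (φ : BoundedLatticeHom A Prop) : A →[lang I] complexAlg I (substMaps I) :=
    evalHom (fun v => φ.comp (act A (e.symm v))) fun v m => by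
      rw [symm_smul, map_mul]
      rfl
  refine hW.sub _ (hW.prod _ _ fun _ => ?_) A (prodHom f) fun a b hab =>
    eq_of_forall_hom_prop_iff fun φ => ?_
  · exact setAlg_eq_complexAlg hV ▸ hK ⟨_, substMaps_subset_weakSet, hV, rfl⟩
  · have h : φ (act A (e.symm (e 1)) a) ↔ φ (act A (e.symm (e 1)) b) :=
      Set.ext_iff.1 (congrFun hab φ) (e 1)
    simpa only [e.symm_apply_apply, map_one, boolEnd_one_apply] using h

end SetAlg

/-! ### Superamalgamation -/

section Superamalgamation

variable {A B C : Alg.{u} I} [Fact (A ∈ SA I)] [Fact (B ∈ SA I)] [Fact (C ∈ SA I)]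
  (f : A →[lang I] B) (g : A →[lang I] C)

/-- Pairs of ultrafilters, of `B` and of `C`, with the same restriction to `A`. -/
def UltPair : Type u :=
  {x : BoundedLatticeHom B Prop × BoundedLatticeHom C Prop //
    x.1.comp (toBoolHom f) = x.2.comp (toBoolHom g)}

noncomputable instance : MulAction (SubstMonoid I)ᵐᵒᵖ (UltPair f g) where
  smul m x := ⟨(x.1.1.comp (act B m.unop), x.1.2.comp (act C m.unop)), by
    rw [BoundedLatticeHom.comp_assoc, ← toBoolHom_comp_act, ← BoundedLatticeHom.comp_assoc, x.2,
      BoundedLatticeHom.comp_assoc, BoundedLatticeHom.comp_assoc, toBoolHom_comp_act]⟩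
  one_smul x := Subtype.ext <| by
    change (x.1.1.comp (act B 1), x.1.2.comp (act C 1)) = x.1
    rw [map_one, map_one]
    rfl
  mul_smul m n x := Subtype.ext <| by
    change (x.1.1.comp (act B (n.unop * m.unop)), x.1.2.comp (act C (n.unop * m.unop))) = _
    rw [map_mul, map_mul]
    rfl

/-- The embedding of the left factor into the amalgam. -/
noncomputable def amalgamLeft : B →[lang I] complexAlg I (UltPair f g) :=
  evalHom (fun x => x.1.1) fun _ _ => rfl

/-- The embedding of the right factor into the amalgam. -/
noncomputable def amalgamRight : C →[lang I] complexAlg I (UltPair f g) :=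
  evalHom (fun x => x.1.2) fun _ _ => rfl

variable {f g}

theorem amalgamLeft_injective (hg : Function.Injective g) :
    Function.Injective (amalgamLeft f g) := fun b b' h =>
  eq_of_forall_hom_prop_iff fun φ => by
    obtain ⟨ψ, hψ⟩ := exists_comp_eq_of_injective (φ.comp (toBoolHom f)) (g := toBoolHom g) hg
    exact Set.ext_iff.1 h (⟨(φ, ψ), hψ.symm⟩ : UltPair f g)

theorem amalgamRight_injective (hf : Function.Injective f) :
    Function.Injective (amalgamRight f g) := fun c c' h =>
  eq_of_forall_hom_prop_iff fun ψ => by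
    obtain ⟨φ, hφ⟩ := exists_comp_eq_of_injective (ψ.comp (toBoolHom g)) (g := toBoolHom f) hf
    exact Set.ext_iff.1 h (⟨(φ, ψ), hφ⟩ : UltPair f g)

theorem amalgamLeft_apply_eq (a : A) : amalgamLeft f g (f a) = amalgamRight f g (g a) :=
  complexAlg_ext fun x => iff_of_eq (DFunLike.congr_fun x.2 a)

theorem exists_between_of_amalgamLeft_le {b : B} {c : C}
    (h : le (amalgamLeft f g b) (amalgamRight f g c)) : ∃ a : A, le b (f a) ∧ le (g a) c := by
  by_contra hbc
  simp only [le_iff_le] at hbc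
  obtain ⟨φ, ψ, hφψ, hb, hc⟩ :=
    exists_comp_eq_comp_of_not_exists_between (toBoolHom f) (toBoolHom g) hbc
  exact hc (complexAlg_le_iff.1 h ⟨(φ, ψ), hφψ⟩ hb)

theorem exists_between_of_amalgamRight_le {b : B} {c : C}
    (h : le (amalgamRight f g c) (amalgamLeft f g b)) : ∃ a : A, le c (g a) ∧ le (f a) b := by
  by_contra hcb
  simp only [le_iff_le] at hcb
  obtain ⟨ψ, φ, hψφ, hc, hb⟩ :=
    exists_comp_eq_comp_of_not_exists_between (toBoolHom g) (toBoolHom f) hcb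
  exact hb (complexAlg_le_iff.1 h ⟨(φ, ψ), hψφ.symm⟩ hc)

end Superamalgamation

variable (I) in
theorem hasSuperamalgamation_SA : HasSuperamalgamation (SA I) := by
  intro A hA B hB C hC f g hf hg
  have : Fact (A ∈ SA I) := ⟨hA⟩
  have : Fact (B ∈ SA I) := ⟨hB⟩
  have : Fact (C ∈ SA I) := ⟨hC⟩
  exact ⟨complexAlg I (UltPair f g), complexAlg_mem_SA, amalgamLeft f g, amalgamRight f g,
    amalgamLeft_injective hg, amalgamRight_injective hf, amalgamLeft_apply_eq,
    fun _ _ => exists_between_of_amalgamLeft_le, fun _ _ => exists_between_of_amalgamRight_le⟩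

end ComplexAlg
end SubstAlg

theorem mainTheorem7_general (I : Type u) :
    (Infinite I → SubstAlg.SA I = SubstAlg.WSA I) ∧
      SubstAlg.HasSuperamalgamation (SubstAlg.SA I) :=
  ⟨fun _ => SubstAlg.SA_subset_WSA.antisymm SubstAlg.WSA_subset_SA,
    SubstAlg.hasSuperamalgamation_SA I⟩

theorem mainTheorem7 (α : Ordinal.{u}) (hα : Ordinal.omega0 ≤ α) :
    SubstAlg.SA α.ToType = SubstAlg.WSA α.ToType ∧
      SubstAlg.HasSuperamalgamation (SubstAlg.SA α.ToType) := by
  have : Infinite α.ToType := by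
    rwa [Cardinal.infinite_iff, Cardinal.mk_toType, Ordinal.aleph0_le_card]
  exact (mainTheorem7_general α.ToType).imp_left fun h => h this
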